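/- For $\lambda\in(0,1)$, an integer $\ell\ge 1$ and $\underline h=(h_1,\dots,h_\ell)\in\mathbb R^\ell$ let $$Z_{\ell,\underline h}=\sum_{\sigma\in\{-1,1\}^{\ell}}\exp\Big(\sum_{i=1}^\ell\{\lambda\,\sigma(i)\sigma(i+1)+h_i\sigma(i)\}\Big),\qquad \sigma(\ell+1)=\sigma(1),$$ be the partition function of the periodic nearest neighbour Ising chain, and put $$m_i=\frac{\partial}{\partial h_i}\log Z_{\ell,\underline h},\qquad Z^*_{\ell,\underline h}=Z_{\ell,\underline h}\Big\{\prod_{i=1}^\ell(e^{h_i}+e^{-h_i})\Big\}^{-1},\qquad u_i=\tanh(h_i),$$ and let $A_0=\log Z^*_{\ell,\underline 0}$, the constant term of the expansion of $\log Z^*_{\ell,\underline h}$ in powers of $u_1,\dots,u_\ell$. For an external magnetic field $h_{\rm ext}$ the effective Hamiltonian is $$H^{\rm eff}_{\ell,\underline h}=\sum_{i=1}^\ell\Big\{-\frac{m_i^2}{2}+h_im_i-h_{\rm ext}m_i-\log(e^{h_i}+e^{-h_i})\Big\}-\log Z^*_{\ell,\underline h}+A_0 .$$ Let $h_0=\frac14\left(\frac12-\frac38\right)$.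 **Theorem.** There is a constant $c>0$ (depending on none of the quantities below) such that, for all $\lambda\in(0,1)$ with $2c\lambda^{2/3}\le\frac12-\frac38$, all $\ell\ge1$ and all $h_{\rm ext}\in[0,h_0]$, the following hold. 1. For every $h_+>0$, the infimum of $H^{\rm eff}_{\ell,\underline h}$ over all $\underline h$ with $|h_i|\le h_+$, $i=1,\dots,\ell$ (equivalently over all $\underline u$ with $|u_i|\le u_+=\tanh h_+$) is attained at a homogeneous $\underline h$ of this set, i.e. one whose components are all equal to each other. 2. The infimum of $H^{\rm eff}_{\ell,\underline h}$ over all $\underline h\in\mathbb R^\ell$ (equivalently over all $\underline u\in(-1,1)^\ell$) is likewise attained at a homogeneous $\underline h$. -/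

import Mathlib

noncomputable section

namespace LayeredIsing

/-- Partition function `Z_{ℓ,h}` of the one-dimensional nearest neighbour Ising chain on the sites
`1, …, ℓ` with periodic boundary conditions (addition in `Fin ℓ` is cyclic), coupling `lam` and
site dependent magnetic field `h`. The spins take values in `ℤˣ = {1, -1}`. -/
def partitionZ (ℓ : ℕ) [NeZero ℓ] (lam : ℝ) (h : Fin ℓ → ℝ) : ℝ :=
  ∑ σ : Fin ℓ → ℤˣ,
    Real.exp (∑ i : Fin ℓ,
      (lam * ((σ i : ℤ) : ℝ) * ((σ (i + 1) : ℤ) : ℝ) + h i * ((σ i : ℤ) : ℝ)))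

/-- The partition function normalised by its value without interaction:
`Z*_{ℓ,h} = Z_{ℓ,h} / ∏ i, (e^{h i} + e^{-h i})`. -/
def partitionZstar (ℓ : ℕ) [NeZero ℓ] (lam : ℝ) (h : Fin ℓ → ℝ) : ℝ :=
  partitionZ ℓ lam h / ∏ i : Fin ℓ, (Real.exp (h i) + Real.exp (-h i))

/-- The magnetization at site `i`: `m i = ∂ (log Z_{ℓ,h}) / ∂ (h i)`. -/
def magnetization (ℓ : ℕ) [NeZero ℓ] (lam : ℝ) (h : Fin ℓ → ℝ) (i : Fin ℓ) : ℝ :=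
  deriv (fun t : ℝ => Real.log (partitionZ ℓ lam (Function.update h i t))) (h i)

/-- The constant term `A₀` of the expansion of `log Z*_{ℓ,h}` in powers of `u i = tanh (h i)`,
that is, the value of `log Z*_{ℓ,h}` at `u = 0`, equivalently at `h = 0`. -/
def constTerm (ℓ : ℕ) [NeZero ℓ] (lam : ℝ) : ℝ :=
  Real.log (partitionZstar ℓ lam (fun _ => 0))

/-- The effective hamiltonian `H^eff_{ℓ,h}` with external magnetic field `hext`. -/
def effHamiltonian (ℓ : ℕ) [NeZero ℓ] (lam hext : ℝ) (h : Fin ℓ → ℝ) : ℝ :=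
  ∑ i : Fin ℓ,
      (-(magnetization ℓ lam h i ^ 2 / 2 - h i * magnetization ℓ lam h i
          + hext * magnetization ℓ lam h i)
        - Real.log (Real.exp (h i) + Real.exp (-h i)))
    - Real.log (partitionZstar ℓ lam h) + constTerm ℓ lam

end LayeredIsing

end

/-! Write m for the Gibbs means of the spins. Up to a constant, the energy is a sum of terms
depending on h_i and m_i only, minus log Z. FKG monotonicity traps m_i between its values at the
constant fields ±H, so some s_i in [-H, H] has a homogeneous chain with magnetization m_i. Convexity
of log Z (`log_partitionZ_add_le`) compares log Z at h and at s. The chessboard estimate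
(`log_partitionZ_le`), a Hölder inequality for traces of transfer matrices, bounds log Z at s by the
average of its values at the constant fields s_i. Hence the average homogeneous energy is at most
that of h, and some s_i does at least as well. Compactness finishes on a box; on the whole space the
constant fields are first brought into [-2, 2]. -/

namespace LayeredIsing

open Finset

/-! ### Gibbs averages and convexity of log Z -/

/-- The Boltzmann weight of a spin configuration. -/
noncomputable def weight (ℓ : ℕ) [NeZero ℓ] (lam : ℝ) (h : Fin ℓ → ℝ) (σ : Fin ℓ → ℤˣ) : ℝ :=
  Real.exp (∑ i : Fin ℓ,
    (lam * ((σ i : ℤ) : ℝ) * ((σ (i + 1) : ℤ) : ℝ) + h i * ((σ i : ℤ) : ℝ)))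

variable {ℓ : ℕ} [NeZero ℓ] {lam : ℝ}

theorem partitionZ_eq_sum_weight (h : Fin ℓ → ℝ) :
    partitionZ ℓ lam h = ∑ σ, weight ℓ lam h σ := rfl

theorem weight_pos (h : Fin ℓ → ℝ) (σ : Fin ℓ → ℤˣ) : 0 < weight ℓ lam h σ := Real.exp_pos _

theorem partitionZ_pos (h : Fin ℓ → ℝ) : 0 < partitionZ ℓ lam h :=
  sum_pos (fun σ _ => weight_pos h σ) univ_nonempty

theorem weight_eq_mul_exp (h s : Fin ℓ → ℝ) (σ : Fin ℓ → ℤˣ) :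
    weight ℓ lam s σ = weight ℓ lam h σ * Real.exp (∑ i, (s i - h i) * ((σ i : ℤ) : ℝ)) := by
  rw [weight, weight, ← Real.exp_add, ← sum_add_distrib]
  congr 1
  exact sum_congr rfl fun i _ => by ring

/-- The Gibbs average of the spin at site `i`. -/
noncomputable def spinMean (ℓ : ℕ) [NeZero ℓ] (lam : ℝ) (h : Fin ℓ → ℝ) (i : Fin ℓ) : ℝ :=
  (∑ σ, weight ℓ lam h σ * ((σ i : ℤ) : ℝ)) / partitionZ ℓ lam h

theorem magnetization_eq_spinMean (h : Fin ℓ → ℝ) (i : Fin ℓ) :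
    magnetization ℓ lam h i = spinMean ℓ lam h i := by
  have hw : ∀ t, partitionZ ℓ lam (Function.update h i t)
      = ∑ σ, weight ℓ lam h σ * Real.exp ((t - h i) * ((σ i : ℤ) : ℝ)) := by
    intro t
    rw [partitionZ_eq_sum_weight]
    refine sum_congr rfl fun σ _ => ?_
    rw [weight_eq_mul_exp h, sum_eq_single i]
    · simp
    · intro j _ hj
      simp [hj]
    · simp
  have hd : HasDerivAt (fun t => partitionZ ℓ lam (Function.update h i t))
      (∑ σ, weight ℓ lam h σ * ((σ i : ℤ) : ℝ)) (h i) := by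
    simp_rw [hw]
    refine HasDerivAt.fun_sum fun σ _ => ?_
    have := ((((hasDerivAt_id (h i)).sub_const (h i)).mul_const ((σ i : ℤ) : ℝ)).exp).const_mul
      (weight ℓ lam h σ)
    simpa using this
  have := hd.log (by simpa using (partitionZ_pos (lam := lam) h).ne')
  rw [magnetization, this.deriv, spinMean, Function.update_eq_self]

theorem abs_spin (u : ℤˣ) : |((u : ℤ) : ℝ)| = 1 := by
  rcases Int.units_eq_one_or u with rfl | rfl <;> simp

theorem abs_spinMean_le_one (h : Fin ℓ → ℝ) (i : Fin ℓ) : |spinMean ℓ lam h i| ≤ 1 := by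
  rw [spinMean, abs_div, abs_of_pos (partitionZ_pos h), div_le_one (partitionZ_pos h)]
  refine (abs_sum_le_sum_abs _ _).trans (le_of_eq ?_)
  rw [partitionZ_eq_sum_weight]
  exact sum_congr rfl fun σ _ => by rw [abs_mul, abs_spin, mul_one, abs_of_pos (weight_pos h σ)]

theorem effHamiltonian_eq (hext : ℝ) (h : Fin ℓ → ℝ) :
    effHamiltonian ℓ lam hext h =
      ∑ i, (h i * spinMean ℓ lam h i - spinMean ℓ lam h i ^ 2 / 2 - hext * spinMean ℓ lam h i)
        - Real.log (partitionZ ℓ lam h) + constTerm ℓ lam := by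
  have hpos : ∀ i, Real.exp (h i) + Real.exp (-h i) ≠ 0 := fun i => by positivity
  rw [effHamiltonian, partitionZstar, Real.log_div (partitionZ_pos h).ne'
    (prod_ne_zero_iff.2 fun i _ => hpos i), Real.log_prod (fun i _ => hpos i)]
  simp_rw [magnetization_eq_spinMean]
  rw [sum_sub_distrib]
  have : ∀ i, -(spinMean ℓ lam h i ^ 2 / 2 - h i * spinMean ℓ lam h i
      + hext * spinMean ℓ lam h i) = h i * spinMean ℓ lam h i - spinMean ℓ lam h i ^ 2 / 2
        - hext * spinMean ℓ lam h i := fun i => by ring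
  simp_rw [this]
  ring

/-- The tangent plane inequality for the convex function `log Z`. -/
theorem log_partitionZ_add_le (h s : Fin ℓ → ℝ) :
    Real.log (partitionZ ℓ lam h) + ∑ i, (s i - h i) * spinMean ℓ lam h i
      ≤ Real.log (partitionZ ℓ lam s) := by
  have hZ := partitionZ_pos (lam := lam) h
  set X : (Fin ℓ → ℤˣ) → ℝ := fun σ => ∑ i, (s i - h i) * ((σ i : ℤ) : ℝ) with hX
  set E := ∑ i, (s i - h i) * spinMean ℓ lam h i with hE
  have hmean : ∑ σ, weight ℓ lam h σ * X σ = E * partitionZ ℓ lam h := by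
    simp_rw [hX, hE, mul_sum, sum_mul]
    rw [sum_comm]
    refine sum_congr rfl fun i _ => ?_
    rw [spinMean, mul_assoc, div_mul_cancel₀ _ hZ.ne', mul_sum]
    exact sum_congr rfl fun σ _ => by ring
  rw [Real.le_log_iff_exp_le (partitionZ_pos s), Real.exp_add, Real.exp_log hZ,
    partitionZ_eq_sum_weight s]
  -- Jensen's inequality: average the tangent line of exp at E, the Gibbs mean of X.
  calc partitionZ ℓ lam h * Real.exp E
      = ∑ σ, weight ℓ lam h σ * (Real.exp E * (X σ - E + 1)) := by
        have : ∀ σ, weight ℓ lam h σ * (Real.exp E * (X σ - E + 1))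
          = Real.exp E * (weight ℓ lam h σ * X σ) + Real.exp E * (1 - E) * weight ℓ lam h σ :=
          fun σ => by ring
        simp_rw [this]
        rw [sum_add_distrib, ← mul_sum, ← mul_sum, hmean, ← partitionZ_eq_sum_weight]
        ring
    _ ≤ ∑ σ, weight ℓ lam s σ := by
        refine sum_le_sum fun σ _ => ?_
        rw [weight_eq_mul_exp h s]
        refine mul_le_mul_of_nonneg_left ?_ (weight_pos h σ).le
        have : Real.exp (X σ) = Real.exp E * Real.exp (X σ - E) := by
          rw [← Real.exp_add]; ring_nf
        change _ ≤ Real.exp (X σ)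
        rw [this]
        exact mul_le_mul_of_nonneg_left (Real.add_one_le_exp _) (Real.exp_pos _).le

/-! ### FKG monotonicity of the magnetization -/

/-- The FKG lattice condition: a ferromagnetic pair term is supermodular and the field term is
modular. -/
theorem weight_mul_weight_le (hlam : 0 ≤ lam) (h : Fin ℓ → ℝ) (σ τ : Fin ℓ → ℤˣ) :
    weight ℓ lam h σ * weight ℓ lam h τ ≤ weight ℓ lam h (σ ⊓ τ) * weight ℓ lam h (σ ⊔ τ) := by
  have key : ∀ a b c d : ℤˣ,
      ((a : ℤ) : ℤ) * c + b * d ≤ ((a ⊓ b : ℤˣ) : ℤ) * ((c ⊓ d : ℤˣ) : ℤ)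
        + ((a ⊔ b : ℤˣ) : ℤ) * ((c ⊔ d : ℤˣ) : ℤ) := by decide
  have key' : ∀ a b : ℤˣ, ((a ⊓ b : ℤˣ) : ℤ) + ((a ⊔ b : ℤˣ) : ℤ) = a + b := by decide
  simp only [weight, ← Real.exp_add, ← sum_add_distrib]
  refine Real.exp_le_exp.2 (sum_le_sum fun i _ => ?_)
  simp only [Pi.inf_apply, Pi.sup_apply]
  have h1 : (_ : ℝ) ≤ _ := Int.cast_le.2 (key (σ i) (τ i) (σ (i + 1)) (τ (i + 1)))
  have h2 : (_ : ℝ) = _ := congrArg Int.cast (key' (σ i) (τ i))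
  simp only [Int.cast_add, Int.cast_mul] at h1 h2
  linear_combination lam * h1 - h i * h2

theorem spin_mono {a b : ℤˣ} (hab : a ≤ b) : ((a : ℤ) : ℝ) ≤ ((b : ℤ) : ℝ) :=
  Int.cast_le.2 (Units.val_le_val.2 hab)

theorem spinMean_mono (hlam : 0 ≤ lam) {h s : Fin ℓ → ℝ} (hs : h ≤ s) (i : Fin ℓ) :
    spinMean ℓ lam h i ≤ spinMean ℓ lam s i := by
  set f : (Fin ℓ → ℤˣ) → ℝ := fun σ => Real.exp (∑ j, (s j - h j) * ((σ j : ℤ) : ℝ)) with hf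
  -- The increasing density f changes the field from h to s. The shift by 1 makes g nonnegative, as
  -- `fkg` requires, and cancels at the end.
  set g : (Fin ℓ → ℤˣ) → ℝ := fun σ => ((σ i : ℤ) : ℝ) + 1 with hg
  have hfm : Monotone f := fun σ τ hστ => Real.exp_le_exp.2 <| sum_le_sum fun j _ =>
    mul_le_mul_of_nonneg_left (spin_mono (hστ j)) (sub_nonneg.2 (hs j))
  have hgm : Monotone g := fun σ τ hστ => add_le_add_left (spin_mono (hστ i)) 1
  have hg0 : 0 ≤ g := fun σ => by
    have := (abs_le.1 (abs_spin (σ i)).le).1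
    simp only [hg, Pi.zero_apply]; linarith
  have := fkg (μ := weight ℓ lam h) f g (fun σ => (weight_pos h σ).le)
    (fun σ => (Real.exp_pos _).le) hg0 hfm hgm (weight_mul_weight_le hlam h)
  have hws : ∀ σ, weight ℓ lam h σ * f σ = weight ℓ lam s σ :=
    fun σ => (weight_eq_mul_exp h s σ).symm
  simp_rw [← mul_assoc, hws, hg, mul_add, mul_one, sum_add_distrib,
    ← partitionZ_eq_sum_weight] at this
  rw [spinMean, spinMean, div_le_div_iff₀ (partitionZ_pos h) (partitionZ_pos s)]
  linarith

/-! ### Homogeneous fields: translation invariance and continuity -/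

theorem weight_const_comp_add (t : ℝ) (k : Fin ℓ) (σ : Fin ℓ → ℤˣ) :
    weight ℓ lam (fun _ => t) (fun i => σ (i + k)) = weight ℓ lam (fun _ => t) σ := by
  rw [weight, weight]
  congr 1
  refine Fintype.sum_equiv (Equiv.addRight k) _ _ fun i => ?_
  simp [add_right_comm]

theorem spinMean_const (t : ℝ) (i j : Fin ℓ) :
    spinMean ℓ lam (fun _ => t) i = spinMean ℓ lam (fun _ => t) j := by
  rw [spinMean, spinMean]
  congr 1
  refine Fintype.sum_equiv ((Equiv.addRight (i - j)).symm.arrowCongr (Equiv.refl ℤˣ)) _ _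
    fun σ => ?_
  have : ((Equiv.addRight (i - j)).symm.arrowCongr (Equiv.refl ℤˣ)) σ
      = fun k => σ (k + (i - j)) := rfl
  rw [this, weight_const_comp_add]
  simp

theorem continuous_partitionZ_const :
    Continuous fun t : ℝ => partitionZ ℓ lam (fun _ => t) := by
  unfold partitionZ; fun_prop

theorem continuous_spinMean_const (i : Fin ℓ) :
    Continuous fun t : ℝ => spinMean ℓ lam (fun _ => t) i := by
  refine Continuous.div ?_ continuous_partitionZ_const fun t => (partitionZ_pos _).ne'
  unfold weight; fun_prop

theorem continuous_effHamiltonian_const (hext : ℝ) :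
    Continuous fun t : ℝ => effHamiltonian ℓ lam hext (fun _ => t) := by
  simp_rw [effHamiltonian_eq]
  have h1 := continuous_spinMean_const (lam := lam) (ℓ := ℓ)
  have h2 := (continuous_partitionZ_const (lam := lam) (ℓ := ℓ)).log
    fun t => (partitionZ_pos _).ne'
  fun_prop

/-! ### Hölder's trace inequality for 2 × 2 matrices -/

open Matrix

/-- A symmetric `2 × 2` matrix expands the Euclidean norm at most by its larger eigenvalue. -/
theorem sq_add_sq_mulVec_le {p q r x y : ℝ} (hy : 0 < y) (hxy : y ≤ x) (htr : p + r = x + y)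
    (hdet : p * r - q * q = x * y) (v w : ℝ) :
    (p * v + q * w) ^ 2 + (q * v + r * w) ^ 2 ≤ x ^ 2 * (v ^ 2 + w ^ 2) := by
  have h1 : (x - p) * (x - r) = q * q := by linear_combination (-x) * htr + hdet
  have hp : 0 ≤ x - p := by nlinarith [mul_self_nonneg q]
  have hr : 0 ≤ x - r := by nlinarith [mul_self_nonneg q]
  have hform : 0 ≤ (x - p) * v ^ 2 - 2 * q * v * w + (x - r) * w ^ 2 := by
    by_cases h0 : (x - p) + (x - r) = 0
    · have hp0 : x - p = 0 := by linarith
      have hr0 : x - r = 0 := by linarith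
      have hq : q = 0 := by rw [hp0, zero_mul] at h1; exact mul_self_eq_zero.1 h1.symm
      simp [hp0, hr0, hq]
    · have h0' : 0 < (x - p) + (x - r) := lt_of_le_of_ne (by linarith) (Ne.symm h0)
      refine nonneg_of_mul_nonneg_right (a := (x - p) + (x - r)) ?_ h0'
      have : ((x - p) + (x - r)) * ((x - p) * v ^ 2 - 2 * q * v * w + (x - r) * w ^ 2)
          = ((x - p) * v - q * w) ^ 2 + ((x - r) * w - q * v) ^ 2 := by
        linear_combination (v ^ 2 + w ^ 2) * h1
      rw [this]; positivity
  -- Cayley–Hamilton: x² − P² = (x + y)(x − P), where x − P is positive semidefinite.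
  have : x ^ 2 * (v ^ 2 + w ^ 2) - ((p * v + q * w) ^ 2 + (q * v + r * w) ^ 2)
      = (x + y) * ((x - p) * v ^ 2 - 2 * q * v * w + (x - r) * w ^ 2) := by
    have hy' : y = p + r - x := by linarith
    subst hy'
    linear_combination (v ^ 2 + w ^ 2) * h1
  have := mul_nonneg (by linarith : 0 ≤ x + y) hform
  linarith

/-- `X` bounds the Euclidean operator norm of the `2 × 2` matrix `P`. -/
def NormBound (P : Matrix (Fin 2) (Fin 2) ℝ) (X : ℝ) : Prop :=
  ∀ v w : ℝ, (P 0 0 * v + P 0 1 * w) ^ 2 + (P 1 0 * v + P 1 1 * w) ^ 2 ≤ X ^ 2 * (v ^ 2 + w ^ 2)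

theorem NormBound.mul {P Q : Matrix (Fin 2) (Fin 2) ℝ} {X Y : ℝ} (hP : NormBound P X)
    (hQ : NormBound Q Y) : NormBound (P * Q) (X * Y) := by
  intro v w
  have h1 := hP (Q 0 0 * v + Q 0 1 * w) (Q 1 0 * v + Q 1 1 * w)
  have h2 := mul_le_mul_of_nonneg_left (hQ v w) (sq_nonneg X)
  simp only [Matrix.mul_apply, Fin.sum_univ_two]
  calc _ = _ := by ring
    _ ≤ _ := h1
    _ ≤ _ := h2
    _ = _ := by ring

theorem NormBound.list_prod {n : ℕ} {A : Fin n → Matrix (Fin 2) (Fin 2) ℝ} {x : Fin n → ℝ}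
    (h : ∀ i, NormBound (A i) (x i)) : NormBound (List.ofFn A).prod (∏ i, x i) := by
  induction n with
  | zero => intro v w; simp
  | succ n ih =>
    rw [List.ofFn_succ, List.prod_cons, Fin.prod_univ_succ]
    exact (h 0).mul (ih fun i => h i.succ)

/-- Trace bound for a `2 × 2` matrix whose norm is at most `X` and whose determinant is `X * Y`. -/
theorem NormBound.trace_le {P : Matrix (Fin 2) (Fin 2) ℝ} {X Y : ℝ} (hP : NormBound P X)
    (hX : 0 < X) (hY : 0 < Y) (hdet : P.det = X * Y) : P.trace ≤ X + Y := by
  rw [Matrix.det_fin_two] at hdet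
  rw [Matrix.trace_fin_two]
  unfold NormBound at hP
  generalize P 0 0 = a, P 0 1 = b, P 1 0 = c, P 1 1 = d at hP hdet ⊢
  -- The form X²|v|² − |Pv|² is nonnegative, so its determinant is too; with det P = XY this bounds
  -- the squared Frobenius norm by X² + Y². The squared trace is that norm plus 2 det P − (b − c)².
  have hdisc : discrim (X ^ 2 - (a ^ 2 + c ^ 2)) (-(2 * (a * b + c * d)))
      (X ^ 2 - (b ^ 2 + d ^ 2)) ≤ 0 := by
    refine discrim_le_zero fun v => ?_
    have := hP v 1
    linarith
  have hF : X ^ 2 * (a ^ 2 + b ^ 2 + c ^ 2 + d ^ 2) ≤ X ^ 2 * (X ^ 2 + Y ^ 2) := by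
    have h2 : (a * d - b * c) ^ 2 = X ^ 2 * Y ^ 2 := by rw [hdet]; ring
    rw [discrim] at hdisc
    linarith
  have hF' := le_of_mul_le_mul_left hF (by positivity)
  refine abs_le_of_sq_le_sq' ?_ (by positivity) |>.2
  nlinarith [sq_nonneg (b - c)]

theorem trace_pow_fin_two {A : Matrix (Fin 2) (Fin 2) ℝ} {x y : ℝ} (htr : A.trace = x + y)
    (hdet : A.det = x * y) (n : ℕ) : (A ^ n).trace = x ^ n + y ^ n := by
  have hsq : A ^ 2 = (x + y) • A - (x * y) • (1 : Matrix (Fin 2) (Fin 2) ℝ) := by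
    rw [← htr, ← hdet, Matrix.trace_fin_two, Matrix.det_fin_two]
    ext i j
    fin_cases i <;> fin_cases j <;>
      simp [pow_two, Matrix.mul_apply, Fin.sum_univ_two] <;> ring
  induction n using Nat.twoStepInduction with
  | zero => simp; norm_num
  | one => simpa using htr
  | more n h0 h1 =>
    have : A ^ (n + 2) = (x + y) • A ^ (n + 1) - (x * y) • A ^ n := by
      rw [pow_add, hsq, mul_sub, mul_smul_comm, mul_smul_comm, mul_one, ← pow_succ]
    rw [this, Matrix.trace_sub, Matrix.trace_smul, Matrix.trace_smul, h0, h1]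
    simp only [smul_eq_mul]
    ring

/-- Normalise each pair so that its n-th powers sum to 1, then apply AM-GM to both products; the two
arithmetic means add up to 1. -/
theorem prod_add_prod_le_prod_rpow {n : ℕ} (hn : n ≠ 0) {x y : Fin n → ℝ} (hx : ∀ i, 0 < x i)
    (hy : ∀ i, 0 < y i) :
    ∏ i, x i + ∏ i, y i ≤ ∏ i, (x i ^ n + y i ^ n) ^ (1 / n : ℝ) := by
  have hn' : (n : ℝ) ≠ 0 := Nat.cast_ne_zero.2 hn
  have hz : ∀ i, 0 < x i ^ n + y i ^ n := fun i => by have := hx i; have := hy i; positivity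
  have key : ∀ u : Fin n → ℝ, (∀ i, 0 < u i) → ∏ i, u i ≤
      (∏ i, (x i ^ n + y i ^ n) ^ (1 / n : ℝ)) * ∑ i, 1 / n * (u i ^ n / (x i ^ n + y i ^ n)) := by
    intro u hu
    have h1 := Real.geom_mean_le_arith_mean_weighted univ (fun _ => (1 / n : ℝ))
      (fun i => u i ^ n / (x i ^ n + y i ^ n)) (fun _ _ => by positivity) (by simp [hn'])
      (fun i _ => by have := hu i; have := hz i; positivity)
    have h2 : ∏ i, u i = (∏ i, (x i ^ n + y i ^ n) ^ (1 / n : ℝ)) *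
        ∏ i, (u i ^ n / (x i ^ n + y i ^ n)) ^ (1 / n : ℝ) := by
      rw [← prod_mul_distrib]
      refine prod_congr rfl fun i _ => ?_
      rw [← Real.mul_rpow (hz i).le (by have := hu i; have := hz i; positivity),
        mul_div_cancel₀ _ (hz i).ne', one_div, Real.pow_rpow_inv_natCast (hu i).le hn]
    rw [h2]
    exact mul_le_mul_of_nonneg_left h1 (prod_nonneg fun i _ => by have := hz i; positivity)
  refine (add_le_add (key x hx) (key y hy)).trans (le_of_eq ?_)
  rw [← mul_add, ← sum_add_distrib]
  have : ∀ i, 1 / (n : ℝ) * (x i ^ n / (x i ^ n + y i ^ n)) +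
      1 / n * (y i ^ n / (x i ^ n + y i ^ n)) = 1 / n := fun i => by
    rw [← mul_add, ← add_div, div_self (hz i).ne', mul_one]
  rw [sum_congr rfl fun i _ => this i]
  simp [hn']

/-- Hölder's inequality for the trace of a product of positive definite `2 × 2` matrices. -/
theorem trace_list_prod_le {n : ℕ} (hn : n ≠ 0) {A : Fin n → Matrix (Fin 2) (Fin 2) ℝ}
    (hsymm : ∀ i, A i 0 1 = A i 1 0) (htr : ∀ i, 0 < (A i).trace) (hdet : ∀ i, 0 < (A i).det) :
    (List.ofFn A).prod.trace ≤ ∏ i, ((A i ^ n).trace) ^ (1 / n : ℝ) := by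
  have hroots : ∀ i, ∃ x y : ℝ, 0 < y ∧ y ≤ x ∧ (A i).trace = x + y ∧ (A i).det = x * y := by
    intro i
    have hd : 0 ≤ (A i).trace ^ 2 - 4 * (A i).det := by
      rw [Matrix.trace_fin_two, Matrix.det_fin_two, hsymm]
      nlinarith [sq_nonneg (A i 0 0 - A i 1 1), sq_nonneg (A i 1 0)]
    have hs := Real.sq_sqrt hd
    have hs0 := Real.sqrt_nonneg ((A i).trace ^ 2 - 4 * (A i).det)
    set s := √((A i).trace ^ 2 - 4 * (A i).det)
    refine ⟨((A i).trace + s) / 2, ((A i).trace - s) / 2, ?_, by linarith, by ring, by linarith⟩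
    have : s < (A i).trace := abs_lt_of_sq_lt_sq' (by linarith [hdet i]) (htr i).le |>.2
    linarith
  choose x y hy hyx hxy_tr hxy_det using hroots
  have hx : ∀ i, 0 < x i := fun i => (hy i).trans_le (hyx i)
  have hN : ∀ i, NormBound (A i) (x i) := fun i v w => by
    have h1 := hxy_tr i
    have h2 := hxy_det i
    rw [Matrix.trace_fin_two] at h1
    rw [Matrix.det_fin_two, hsymm] at h2
    rw [hsymm]
    exact sq_add_sq_mulVec_le (hy i) (hyx i) h1 h2 v w
  have hD : (List.ofFn A).prod.det = (∏ i, x i) * ∏ i, y i := by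
    rw [← prod_mul_distrib, ← Matrix.coe_detMonoidHom, map_list_prod, List.map_ofFn,
      List.prod_ofFn]
    exact prod_congr rfl fun i _ => hxy_det i
  refine ((NormBound.list_prod hN).trace_le (prod_pos fun i _ => hx i) (prod_pos fun i _ => hy i)
    hD).trans ((prod_add_prod_le_prod_rpow hn hx hy).trans (le_of_eq ?_))
  exact prod_congr rfl fun i _ => by rw [trace_pow_fin_two (hxy_tr i) (hxy_det i)]

/-! ### Transfer matrices and the chessboard estimate -/

theorem list_prod_apply_eq_sum {ι : Type*} [Fintype ι] [DecidableEq ι] {n : ℕ}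
    (M : Fin (n + 1) → Matrix ι ι ℝ) (a b : ι) :
    (List.ofFn M).prod a b = ∑ σ : Fin n → ι, ∏ i : Fin (n + 1),
      M i ((Fin.cons a σ : Fin (n + 1) → ι) i) ((Fin.snoc σ b : Fin (n + 1) → ι) i) := by
  induction n generalizing a with
  | zero => simp [Fin.snoc]
  | succ n ih =>
    rw [List.ofFn_succ, List.prod_cons, Matrix.mul_apply]
    rw [← (Fin.consEquiv fun _ => ι).sum_comp, Fintype.sum_prod_type]
    refine sum_congr rfl fun c _ => ?_
    rw [ih, mul_sum]
    refine sum_congr rfl fun σ _ => ?_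
    have hs : (Fin.snoc ((Fin.consEquiv fun _ => ι) (c, σ)) b : Fin (n + 2) → ι)
        = Fin.cons c (Fin.snoc σ b : Fin (n + 1) → ι) :=
      (Fin.cons_snoc_eq_snoc_cons c σ b).symm
    rw [Fin.prod_univ_succ (n := n + 1), hs]
    simp only [Fin.consEquiv_apply, Fin.cons_zero, Fin.cons_succ]

theorem trace_list_prod_eq_sum {ι : Type*} [Fintype ι] [DecidableEq ι] {n : ℕ} [NeZero n]
    (M : Fin n → Matrix ι ι ℝ) :
    (List.ofFn M).prod.trace = ∑ σ : Fin n → ι, ∏ i, M i (σ i) (σ (i + 1)) := by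
  obtain ⟨n, rfl⟩ := Nat.exists_eq_succ_of_ne_zero (NeZero.ne n)
  rw [← (Fin.consEquiv fun _ => ι).sum_comp, Fintype.sum_prod_type, Matrix.trace]
  refine sum_congr rfl fun a _ => ?_
  rw [Matrix.diag_apply, list_prod_apply_eq_sum]
  refine sum_congr rfl fun σ _ => prod_congr rfl fun i _ => ?_
  congr 1
  refine Fin.lastCases ?_ (fun j => ?_) i
  · simp [Fin.consEquiv]
  · simp [Fin.consEquiv]

/-- The single site field matrix. -/
noncomputable def fieldMatrix (t : ℝ) : Matrix (Fin 2) (Fin 2) ℝ :=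
  !![Real.exp t, 0; 0, Real.exp (-t)]

/-- The nearest neighbour transfer matrix. -/
noncomputable def bondMatrix (lam : ℝ) : Matrix (Fin 2) (Fin 2) ℝ :=
  !![Real.exp lam, Real.exp (-lam); Real.exp (-lam), Real.exp lam]

/-- The two spin values, indexed by `Fin 2`. -/
noncomputable def spinEquiv : Fin 2 ≃ ℤˣ where
  toFun := ![1, -1]
  invFun u := if u = 1 then 0 else 1
  left_inv i := by fin_cases i <;> decide
  right_inv u := by rcases Int.units_eq_one_or u with rfl | rfl <;> decide

theorem partitionZ_eq_trace (h : Fin ℓ → ℝ) :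
    partitionZ ℓ lam h =
      (List.ofFn fun i => fieldMatrix (h i) * bondMatrix lam).prod.trace := by
  rw [trace_list_prod_eq_sum, partitionZ]
  refine (Fintype.sum_equiv ((Equiv.refl (Fin ℓ)).arrowCongr spinEquiv) _ _ fun σ => ?_).symm
  rw [Real.exp_sum]
  refine prod_congr rfl fun i _ => ?_
  have hσ : ∀ j, ((Equiv.refl (Fin ℓ)).arrowCongr spinEquiv) σ j = spinEquiv (σ j) :=
    fun _ => rfl
  rw [hσ, hσ, Matrix.mul_apply, Fin.sum_univ_two]
  generalize σ i = a, σ (i + 1) = b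
  fin_cases a <;> fin_cases b <;>
    simp [fieldMatrix, bondMatrix, spinEquiv, Real.exp_add, mul_comm]

/-- The transfer matrix has an invertible symmetric square root. -/
theorem exists_sq_eq_bondMatrix (hlam : 0 < lam) : ∃ S : Matrix (Fin 2) (Fin 2) ℝ,
    S 0 1 = S 1 0 ∧ 0 < S.det ^ 2 ∧ S * S = bondMatrix lam := by
  have hc : 0 ≤ 2 * Real.cosh lam := by positivity
  have hs : 0 < 2 * Real.sinh lam := by have := Real.sinh_pos_iff.2 hlam; positivity
  have h1 := Real.sq_sqrt hc
  have h2 := Real.sq_sqrt hs.le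
  have h3 : 0 < √(2 * Real.cosh lam) := by positivity
  have h4 : 0 < √(2 * Real.sinh lam) := by positivity
  set a := √(2 * Real.cosh lam)
  set b := √(2 * Real.sinh lam)
  have e1 := Real.cosh_eq lam
  have e2 := Real.sinh_eq lam
  -- The bond matrix has eigenvalues 2 cosh λ and 2 sinh λ on (1, 1) and (1, -1); S has their square
  -- roots there.
  refine ⟨!![(a + b) / 2, (a - b) / 2; (a - b) / 2, (a + b) / 2], by simp, ?_, ?_⟩
  · rw [Matrix.det_fin_two]
    simp only [of_apply, cons_val', cons_val_zero, cons_val_one, cons_val_fin_one]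
    have : (a + b) / 2 * ((a + b) / 2) - (a - b) / 2 * ((a - b) / 2) = a * b := by ring
    rw [this]; positivity
  · ext i j
    fin_cases i <;> fin_cases j <;> simp [bondMatrix, Matrix.mul_apply, Fin.sum_univ_two] <;>
      linarith

/-- For invertible S this conjugates a product of non-symmetric matrices D S² into one of symmetric
matrices S D S, with the same trace. -/
theorem mul_list_prod_comm {R : Type*} [Monoid R] (S : R) {n : ℕ} (D : Fin n → R) :
    S * (List.ofFn fun i => D i * (S * S)).prod = (List.ofFn fun i => S * D i * S).prod * S := by
  induction n with
  | zero => simp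
  | succ n ih =>
    rw [List.ofFn_succ, List.prod_cons, List.ofFn_succ, List.prod_cons,
      mul_assoc (S * D 0 * S), ← ih fun i => D i.succ]
    simp only [mul_assoc]

/-- Chessboard estimate for the periodic chain. -/
theorem log_partitionZ_le (hlam : 0 < lam) (h : Fin ℓ → ℝ) :
    Real.log (partitionZ ℓ lam h)
      ≤ ∑ i, 1 / (ℓ : ℝ) * Real.log (partitionZ ℓ lam (fun _ => h i)) := by
  obtain ⟨S, hS, hdet, hSS⟩ := exists_sq_eq_bondMatrix hlam
  have hSu : IsUnit S.det := isUnit_iff_ne_zero.2 fun h0 => by simp [h0] at hdet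
  have htrace : ∀ s : Fin ℓ → ℝ,
      partitionZ ℓ lam s = (List.ofFn fun i => S * fieldMatrix (s i) * S).prod.trace := by
    intro s
    rw [partitionZ_eq_trace, ← hSS, ← Matrix.mul_nonsing_inv_cancel_right S
      (List.ofFn fun i => S * fieldMatrix (s i) * S).prod hSu, ← mul_list_prod_comm,
      Matrix.trace_mul_comm, Matrix.nonsing_inv_mul_cancel_left _ _ hSu]
  have hconst : ∀ t : ℝ, partitionZ ℓ lam (fun _ => t) = ((S * fieldMatrix t * S) ^ ℓ).trace := by
    intro t
    rw [htrace, List.ofFn_const, List.prod_replicate]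
  have hle := trace_list_prod_le (NeZero.ne ℓ) (A := fun i => S * fieldMatrix (h i) * S)
    (fun i => by
      simp [fieldMatrix, Matrix.mul_apply, Fin.sum_univ_two, hS]; ring)
    (fun i => by
      have h1 := Real.exp_pos (h i)
      have h2 := Real.exp_pos (-h i)
      have h3 : (S * fieldMatrix (h i) * S).trace = Real.exp (h i) * (S 0 0 ^ 2 + S 1 0 ^ 2)
          + Real.exp (-h i) * (S 1 1 ^ 2 + S 1 0 ^ 2) := by
        rw [Matrix.trace_fin_two]
        simp [fieldMatrix, Matrix.mul_apply, Fin.sum_univ_two, hS]; ring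
      rw [h3]
      -- A zero trace would make the first column of S vanish, against its invertibility.
      refine lt_of_le_of_ne (by positivity) fun h0 => ?_
      have h4 : Real.exp (h i) * (S 0 0 ^ 2 + S 1 0 ^ 2) = 0 := by
        refine le_antisymm ?_ (by positivity)
        have : 0 ≤ Real.exp (-h i) * (S 1 1 ^ 2 + S 1 0 ^ 2) := by positivity
        linarith
      have h5 := (mul_eq_zero.1 h4).resolve_left h1.ne'
      have h6 : S 0 0 = 0 := by nlinarith [sq_nonneg (S 0 0), sq_nonneg (S 1 0)]
      have h7 : S 1 0 = 0 := by nlinarith [sq_nonneg (S 0 0), sq_nonneg (S 1 0)]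
      simp [Matrix.det_fin_two, h6, h7] at hdet)
    (fun i => by
      have : (S * fieldMatrix (h i) * S).det = S.det ^ 2 := by
        have : (fieldMatrix (h i)).det = 1 := by
          simp [fieldMatrix, Matrix.det_fin_two, ← Real.exp_add]
        rw [Matrix.det_mul, Matrix.det_mul, this]; ring
      rw [this]; exact hdet)
  rw [← htrace] at hle
  simp_rw [← hconst] at hle
  refine (Real.log_le_log (partitionZ_pos h) hle).trans (le_of_eq ?_)
  rw [Real.log_prod fun i _ => (Real.rpow_pos_of_pos (partitionZ_pos _) _).ne']
  exact sum_congr rfl fun i _ => Real.log_rpow (partitionZ_pos _) _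

/-! ### Reduction to homogeneous fields -/

theorem effHamiltonian_const (hext t : ℝ) (i : Fin ℓ) :
    effHamiltonian ℓ lam hext (fun _ => t) =
      ℓ * (t * spinMean ℓ lam (fun _ => t) i - spinMean ℓ lam (fun _ => t) i ^ 2 / 2
        - hext * spinMean ℓ lam (fun _ => t) i)
        - Real.log (partitionZ ℓ lam (fun _ => t)) + constTerm ℓ lam := by
  rw [effHamiltonian_eq, sum_congr rfl fun j _ => by rw [spinMean_const t j i], sum_const,
    card_univ, Fintype.card_fin, nsmul_eq_mul]

/-- Every configuration in a box has at least the energy of some homogeneous one in the box. -/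
theorem exists_effHamiltonian_const_le (hlam : 0 < lam) (hext : ℝ) {H : ℝ} (hH : 0 ≤ H)
    {h : Fin ℓ → ℝ} (hh : ∀ i, |h i| ≤ H) :
    ∃ t, |t| ≤ H ∧ effHamiltonian ℓ lam hext (fun _ => t) ≤ effHamiltonian ℓ lam hext h := by
  have hsol : ∀ i, ∃ t, |t| ≤ H ∧ spinMean ℓ lam (fun _ => t) i = spinMean ℓ lam h i := by
    intro i
    have hm : spinMean ℓ lam h i ∈ Set.Icc (spinMean ℓ lam (fun _ => -H) i)
        (spinMean ℓ lam (fun _ => H) i) :=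
      ⟨spinMean_mono hlam.le (fun j => (abs_le.1 (hh j)).1) i,
        spinMean_mono hlam.le (fun j => (abs_le.1 (hh j)).2) i⟩
    obtain ⟨t, ht, hte⟩ := intermediate_value_Icc (by linarith : -H ≤ H)
      (continuous_spinMean_const (lam := lam) i).continuousOn hm
    exact ⟨t, abs_le.2 ht, hte⟩
  choose s hs hsm using hsol
  have hl : (ℓ : ℝ) ≠ 0 := Nat.cast_ne_zero.2 (NeZero.ne ℓ)
  have hsum : ∑ i, 1 / (ℓ : ℝ) * effHamiltonian ℓ lam hext (fun _ => s i)
      ≤ effHamiltonian ℓ lam hext h := by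
    -- Matching magnetizations change the site terms only by (s_i − h_i) m_i, which is the linear
    -- term of the tangent plane at h.
    have h1 := log_partitionZ_add_le (lam := lam) h s
    have h2 := log_partitionZ_le hlam s
    have h3 : ∀ i, 1 / (ℓ : ℝ) * effHamiltonian ℓ lam hext (fun _ => s i)
        = ((h i * spinMean ℓ lam h i - spinMean ℓ lam h i ^ 2 / 2 - hext * spinMean ℓ lam h i)
          + (s i - h i) * spinMean ℓ lam h i)
          - 1 / (ℓ : ℝ) * Real.log (partitionZ ℓ lam (fun _ => s i))
          + 1 / (ℓ : ℝ) * constTerm ℓ lam := by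
      intro i
      rw [effHamiltonian_const hext (s i) i, hsm]
      field_simp
      ring
    have h4 : ∑ _i : Fin ℓ, 1 / (ℓ : ℝ) * constTerm ℓ lam = constTerm ℓ lam := by
      rw [sum_const, card_univ, Fintype.card_fin, nsmul_eq_mul]
      field_simp
    rw [sum_congr rfl fun i _ => h3 i, sum_add_distrib, sum_sub_distrib, sum_add_distrib, h4,
      effHamiltonian_eq]
    linarith
  obtain ⟨i, -, hi⟩ : ∃ i ∈ (univ : Finset (Fin ℓ)),
      1 / (ℓ : ℝ) * effHamiltonian ℓ lam hext (fun _ => s i)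
        ≤ 1 / (ℓ : ℝ) * effHamiltonian ℓ lam hext h := by
    refine exists_le_of_sum_le univ_nonempty (hsum.trans (le_of_eq ?_))
    rw [sum_const, card_univ, Fintype.card_fin, nsmul_eq_mul]
    field_simp
  exact ⟨s i, hs i, le_of_mul_le_mul_left hi (by have := NeZero.pos ℓ; positivity)⟩

/-- The energy of homogeneous configurations is compared by convexity of `log Z`. -/
theorem mul_le_effHamiltonian_const_sub (hext s t : ℝ) (i : Fin ℓ) :
    ℓ * ((spinMean ℓ lam (fun _ => t) i - spinMean ℓ lam (fun _ => s) i)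
      * (s - (spinMean ℓ lam (fun _ => t) i + spinMean ℓ lam (fun _ => s) i) / 2 - hext))
      ≤ effHamiltonian ℓ lam hext (fun _ => t) - effHamiltonian ℓ lam hext (fun _ => s) := by
  have h1 := log_partitionZ_add_le (lam := lam) (fun _ : Fin ℓ => t) (fun _ => s)
  rw [sum_congr rfl fun j _ => by rw [spinMean_const t j i], sum_const,
    card_univ, Fintype.card_fin, nsmul_eq_mul] at h1
  rw [effHamiltonian_const hext t i, effHamiltonian_const hext s i]
  linarith

/-- As |m| ≤ 1 and 0 ≤ hext ≤ 1, the factor s − (m + m')/2 − hext is nonnegative at s = 2 and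
nonpositive at s = -2, so moving t in to the nearer endpoint cannot raise the energy. -/
theorem exists_effHamiltonian_const_le_of_abs_le_two (hlam : 0 < lam) {hext : ℝ}
    (hext0 : 0 ≤ hext) (hext1 : hext ≤ 1) (t : ℝ) :
    ∃ s, |s| ≤ 2 ∧
      effHamiltonian ℓ lam hext (fun _ => s) ≤ effHamiltonian ℓ lam hext (fun _ => t) := by
  have hm : ∀ s, |spinMean ℓ lam (fun _ => s) 0| ≤ 1 := fun s => abs_spinMean_le_one _ _
  have hm2 := abs_le.1 (hm t)
  rcases le_or_gt |t| 2 with ht | ht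
  · exact ⟨t, ht, le_rfl⟩
  rcases lt_abs.1 ht with ht | ht
  · refine ⟨2, by simp, sub_nonneg.1 (le_trans ?_ (mul_le_effHamiltonian_const_sub hext 2 t 0))⟩
    have := abs_le.1 (hm 2)
    refine mul_nonneg (Nat.cast_nonneg _) (mul_nonneg (sub_nonneg.2 ?_) (by linarith))
    exact spinMean_mono hlam.le (fun _ => ht.le) 0
  · refine ⟨-2, by simp,
      sub_nonneg.1 (le_trans ?_ (mul_le_effHamiltonian_const_sub hext (-2) t 0))⟩
    have := abs_le.1 (hm (-2))
    refine mul_nonneg (Nat.cast_nonneg _)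
      (mul_nonneg_of_nonpos_of_nonpos (sub_nonpos.2 ?_) (by linarith))
    exact spinMean_mono hlam.le (fun _ => (by linarith : t ≤ -2)) 0

theorem exists_isMinOn_effHamiltonian_const (hext : ℝ) {H : ℝ} (hH : 0 ≤ H) :
    ∃ t, |t| ≤ H ∧ ∀ s, |s| ≤ H →
      effHamiltonian ℓ lam hext (fun _ => t) ≤ effHamiltonian ℓ lam hext (fun _ => s) := by
  obtain ⟨t, ht, hmin⟩ := (isCompact_Icc (a := -H) (b := H)).exists_isMinOn
    (Set.nonempty_Icc.2 (by linarith))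
    (continuous_effHamiltonian_const (ℓ := ℓ) (lam := lam) hext).continuousOn
  exact ⟨t, abs_le.2 ht, fun s hs => hmin (abs_le.1 hs)⟩

end LayeredIsing

theorem mainTheorem3 :
    ∃ c : ℝ, 0 < c ∧
      ∀ lam : ℝ, 0 < lam → lam < 1 → 2 * c * lam ^ (2 / 3 : ℝ) ≤ 1 / 2 - 3 / 8 →
      ∀ (ℓ : ℕ) [NeZero ℓ] (hext : ℝ), 0 ≤ hext → hext ≤ 1 / 4 * (1 / 2 - 3 / 8) →
        (∀ hplus : ℝ, 0 < hplus →
          ∃ t : ℝ, |t| ≤ hplus ∧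
            IsLeast (LayeredIsing.effHamiltonian ℓ lam hext '' {h | ∀ i, |h i| ≤ hplus})
              (LayeredIsing.effHamiltonian ℓ lam hext (fun _ => t))) ∧
        (∃ t : ℝ,
          IsLeast (Set.range (LayeredIsing.effHamiltonian ℓ lam hext))
            (LayeredIsing.effHamiltonian ℓ lam hext (fun _ => t))) := by
  -- Nothing is perturbative in λ, so any positive constant would serve.
  refine ⟨1, one_pos, fun lam hlam _ _ ℓ _ hext hext0 hext1 => ⟨fun H hH => ?_, ?_⟩⟩
  · obtain ⟨t, ht, hmin⟩ :=
      LayeredIsing.exists_isMinOn_effHamiltonian_const (ℓ := ℓ) (lam := lam) hext hH.le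
    refine ⟨t, ht, ⟨_, fun _ => ht, rfl⟩, ?_⟩
    rintro _ ⟨h, hh, rfl⟩
    obtain ⟨s, hs, hle⟩ := LayeredIsing.exists_effHamiltonian_const_le hlam hext hH.le hh
    exact (hmin s hs).trans hle
  · obtain ⟨t, -, hmin⟩ :=
      LayeredIsing.exists_isMinOn_effHamiltonian_const (ℓ := ℓ) (lam := lam) hext zero_le_two
    refine ⟨t, ⟨_, rfl⟩, ?_⟩
    rintro _ ⟨h, rfl⟩
    -- Any h lies in the box whose half-width is its sup norm.
    obtain ⟨s, -, hle⟩ := LayeredIsing.exists_effHamiltonian_const_le hlam hext (norm_nonneg h)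
      fun i => norm_le_pi_norm h i
    obtain ⟨r, hr, hle'⟩ := LayeredIsing.exists_effHamiltonian_const_le_of_abs_le_two (ℓ := ℓ)
      hlam hext0 (by linarith) s
    exact (hmin r hr).trans (hle'.trans hle)
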